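/- All Hilbert spaces are complex, $\hat\otimes_2$ is the Hilbertian tensor product and $(-)^\dagger$ the Hilbert adjoint. Let $(H,\mu)$ be a commutative Hilbertian Frobenius semigroup: $H$ is a Hilbert space and $\mu\colon H\hat\otimes_2 H\to H$ is a bounded linear map that is associative and commutative and satisfies the Frobenius condition $$(\mu\hat\otimes_2 \mathrm{id})\circ\alpha^{-1}\circ(\mathrm{id}\hat\otimes_2\mu^\dagger)=\mu^\dagger\circ\mu=(\mathrm{id}\hat\otimes_2\mu)\circ\alpha\circ(\mu^\dagger\hat\otimes_2 \mathrm{id}),$$ where $\alpha\colon (H\hat\otimes_2 H)\hat\otimes_2 H\to H\hat\otimes_2(H\hat\otimes_2 H)$ is the associativity constraint. Let $J=J(H,\mu)$ be the Jacobson radical of the algebra $H$ with product $uv=\mu(u\otimes v)$, that is, the intersection of all its maximal modular ideals, and let $G=G(H,\mu)=\{x\in H\setminus\{0\}\colon \mu^\dagger(x)=x\otimes x\}$ be the set of group-like elements. For a set $X$ and a map $w\colon X\to[C,+\infty[$ with $C>0$, let $\ell^2_w(X)$ be the Hilbert space of all $f\colon X\to\mathbb{C}$ with $\sum_{x\in X}w(x)|f(x)|^2<\infty$,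 with inner product $\langle f,g\rangle_w=\sum_{x\in X}w(x)f(x)\overline{g(x)}$, and let $\mu_X\colon \ell^2_w(X)\hat\otimes_2\ell^2_w(X)\to\ell^2_w(X)$ be the bounded linear map with $\mu_X(f\otimes g)=fg$ (pointwise product). Then: 1. $J^\perp$ is a closed subalgebra of $(H,\mu)$. 2. The map $w\colon G\to\,]0,+\infty[$, $w(x)=\frac{1}{\|x\|^2}$, takes its values in $\big[\frac{1}{\|\mu\|_{\mathrm{op}}^2},+\infty\big[$; in particular $\|\mu\|_{\mathrm{op}}>0$ whenever $G\neq\emptyset$. (If $G=\emptyset$, then $w$ is the empty map.) 3. With the multiplication restricted from $\mu$, $J^\perp$ is unitarily isomorphic as a semigroup to $(\ell^2_w(G),\mu_G)$: there is a unitary map $U\colon J^\perp\to\ell^2_w(G)$ with $U(uv)=U(u)\,U(v)$ for all $u,v\in J^\perp$. -/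

import Mathlib

open scoped TensorProduct ComplexConjugate

noncomputable section

namespace HilbFrob

/-! ### The Hilbertian tensor product -/

section Tensor

variable {H K L H' K' : Type*}
  [NormedAddCommGroup H] [InnerProductSpace ℂ H]
  [NormedAddCommGroup K] [InnerProductSpace ℂ K]
  [NormedAddCommGroup L] [InnerProductSpace ℂ L]
  [NormedAddCommGroup H'] [InnerProductSpace ℂ H']
  [NormedAddCommGroup K'] [InnerProductSpace ℂ K']

/-- The Hilbertian tensor product: the completion of the algebraic tensor product for the
inner product with `⟪x ⊗ y, x' ⊗ y'⟫ = ⟪x, x'⟫ * ⟪y, y'⟫`. -/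
def HTensor (H K : Type*) [NormedAddCommGroup H] [InnerProductSpace ℂ H]
    [NormedAddCommGroup K] [InnerProductSpace ℂ K] : Type _ :=
  UniformSpace.Completion (H ⊗[ℂ] K)

instance : NormedAddCommGroup (HTensor H K) :=
  inferInstanceAs (NormedAddCommGroup (UniformSpace.Completion (H ⊗[ℂ] K)))
instance : InnerProductSpace ℂ (HTensor H K) :=
  inferInstanceAs (InnerProductSpace ℂ (UniformSpace.Completion (H ⊗[ℂ] K)))
instance : CompleteSpace (HTensor H K) :=
  inferInstanceAs (CompleteSpace (UniformSpace.Completion (H ⊗[ℂ] K)))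

/-- The inclusion of the algebraic tensor product. -/
def incl (H K : Type*) [NormedAddCommGroup H] [InnerProductSpace ℂ H]
    [NormedAddCommGroup K] [InnerProductSpace ℂ K] : H ⊗[ℂ] K →ₗᵢ[ℂ] HTensor H K :=
  (UniformSpace.Completion.toComplₗᵢ : H ⊗[ℂ] K →ₗᵢ[ℂ] UniformSpace.Completion (H ⊗[ℂ] K))

theorem denseRange_incl : DenseRange (incl H K) :=
  UniformSpace.Completion.denseRange_coe (α := H ⊗[ℂ] K)

/-- The elementary tensor `x ⊗ y`. -/
def tmul (x : H) (y : K) : HTensor H K := incl H K (x ⊗ₜ[ℂ] y)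

/-- The extension by continuity of a bounded linear map on the algebraic tensor product. -/
def tlift [CompleteSpace L] (f : H ⊗[ℂ] K →L[ℂ] L) : HTensor H K →L[ℂ] L :=
  f.extend (incl H K).toContinuousLinearMap

theorem tlift_incl [CompleteSpace L] (f : H ⊗[ℂ] K →L[ℂ] L) (t : H ⊗[ℂ] K) :
    tlift f (incl H K t) = f t :=
  f.extend_eq (e := (incl H K).toContinuousLinearMap) denseRange_incl
    (incl H K).isometry.isUniformInducing t

/-- The map `f ⊗ g` on Hilbertian tensor products. -/
def tmap (f : H →L[ℂ] H') (g : K →L[ℂ] K') : HTensor H K →L[ℂ] HTensor H' K' :=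
  tlift ((incl H' K').toContinuousLinearMap ∘L TensorProduct.mapL f g)

theorem tmap_tmul (f : H →L[ℂ] H') (g : K →L[ℂ] K') (x : H) (y : K) :
    tmap f g (tmul x y) = tmul (f x) (g y) :=
  tlift_incl _ _

theorem inner_tmul (x x' : H) (y y' : K) :
    inner ℂ (tmul x y) (tmul x' y') = inner ℂ x x' * inner ℂ y y' := by
  simp [tmul]

/-- The symmetry `x ⊗ y ↦ y ⊗ x`. -/
def tcomm (H K : Type*) [NormedAddCommGroup H] [InnerProductSpace ℂ H]
    [NormedAddCommGroup K] [InnerProductSpace ℂ K] : HTensor H K →L[ℂ] HTensor K H :=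
  tlift ((incl K H).comp (TensorProduct.commIsometry ℂ H K).toLinearIsometry).toContinuousLinearMap

theorem tcomm_tmul (x : H) (y : K) : tcomm H K (tmul x y) = tmul y x :=
  tlift_incl _ _

/-- The canonical map from `(H ⊗ K) ⊗ L` to its iterated completion. -/
def assocEmbL (H K L : Type*) [NormedAddCommGroup H] [InnerProductSpace ℂ H]
    [NormedAddCommGroup K] [InnerProductSpace ℂ K]
    [NormedAddCommGroup L] [InnerProductSpace ℂ L] :
    (H ⊗[ℂ] K) ⊗[ℂ] L →ₗᵢ[ℂ] HTensor (HTensor H K) L :=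
  (incl (HTensor H K) L).comp (LinearIsometry.rTensor L (incl H K))

/-- The canonical map from `H ⊗ (K ⊗ L)` to its iterated completion. -/
def assocEmbR (H K L : Type*) [NormedAddCommGroup H] [InnerProductSpace ℂ H]
    [NormedAddCommGroup K] [InnerProductSpace ℂ K]
    [NormedAddCommGroup L] [InnerProductSpace ℂ L] :
    H ⊗[ℂ] (K ⊗[ℂ] L) →ₗᵢ[ℂ] HTensor H (HTensor K L) :=
  (incl H (HTensor K L)).comp (LinearIsometry.lTensor H (incl K L))

theorem denseRange_rTensor (L : Type*) [NormedAddCommGroup L] [InnerProductSpace ℂ L]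
    (f : H →ₗᵢ[ℂ] H') (hf : DenseRange f) : DenseRange (f.rTensor L) := by
  have key : ∀ t : H' ⊗[ℂ] L, t ∈ (LinearMap.range (f.rTensor L).toLinearMap).topologicalClosure := by
    intro t
    induction t with
    | zero => exact Submodule.zero_mem _
    | add a b ha hb => exact Submodule.add_mem _ ha hb
    | tmul a b =>
      refine hf.induction_on (p := fun a => a ⊗ₜ[ℂ] b ∈
        (LinearMap.range (f.rTensor L).toLinearMap).topologicalClosure) a ?_ ?_
      · refine IsClosed.preimage ?_ (Submodule.isClosed_topologicalClosure _)
        exact TensorProduct.continuous_tmul.comp (by fun_prop : Continuous fun a : H' => (a, b))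
      · intro x
        exact Submodule.le_topologicalClosure _ ⟨x ⊗ₜ b, rfl⟩
  intro t
  exact key t

theorem denseRange_lTensor (L : Type*) [NormedAddCommGroup L] [InnerProductSpace ℂ L]
    (f : H →ₗᵢ[ℂ] H') (hf : DenseRange f) : DenseRange (f.lTensor L) := by
  have key : ∀ t : L ⊗[ℂ] H', t ∈ (LinearMap.range (f.lTensor L).toLinearMap).topologicalClosure := by
    intro t
    induction t with
    | zero => exact Submodule.zero_mem _
    | add a b ha hb => exact Submodule.add_mem _ ha hb
    | tmul b a =>
      refine hf.induction_on (p := fun a => b ⊗ₜ[ℂ] a ∈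
        (LinearMap.range (f.lTensor L).toLinearMap).topologicalClosure) a ?_ ?_
      · refine IsClosed.preimage ?_ (Submodule.isClosed_topologicalClosure _)
        exact TensorProduct.continuous_tmul.comp (by fun_prop : Continuous fun a : H' => (b, a))
      · intro x
        exact Submodule.le_topologicalClosure _ ⟨b ⊗ₜ x, rfl⟩
  intro t
  exact key t

theorem denseRange_assocEmbL : DenseRange (assocEmbL H K L).toLinearMap :=
  denseRange_incl.comp (denseRange_rTensor L (incl H K) denseRange_incl) (incl _ _).continuous

theorem denseRange_assocEmbR : DenseRange (assocEmbR H K L).toLinearMap :=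
  denseRange_incl.comp (denseRange_lTensor H (incl K L) denseRange_incl) (incl _ _).continuous

/-- The unitary associativity constraint `(x ⊗ y) ⊗ z ↦ x ⊗ (y ⊗ z)`. -/
def tassoc (H K L : Type*) [NormedAddCommGroup H] [InnerProductSpace ℂ H]
    [NormedAddCommGroup K] [InnerProductSpace ℂ K]
    [NormedAddCommGroup L] [InnerProductSpace ℂ L] :
    HTensor (HTensor H K) L ≃ₗᵢ[ℂ] HTensor H (HTensor K L) :=
  LinearEquiv.extendOfIsometry (TensorProduct.assoc ℂ H K L)
    (assocEmbL H K L).toLinearMap (assocEmbR H K L).toLinearMap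
    denseRange_assocEmbL denseRange_assocEmbR (fun x => by
      rw [LinearIsometry.coe_toLinearMap, LinearIsometry.coe_toLinearMap,
        LinearIsometry.norm_map, LinearIsometry.norm_map, TensorProduct.norm_assoc])

theorem tassoc_tmul (x : H) (y : K) (z : L) :
    tassoc H K L (tmul (tmul x y) z) = tmul x (tmul y z) :=
  LinearEquiv.extendOfIsometry_eq (TensorProduct.assoc ℂ H K L)
    (assocEmbL H K L).toLinearMap (assocEmbR H K L).toLinearMap
    denseRange_assocEmbL denseRange_assocEmbR _ ((x ⊗ₜ[ℂ] y) ⊗ₜ[ℂ] z)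

end Tensor

/-! ### Hilbertian Frobenius semigroups -/

section Semigroup

variable {H K : Type*}
  [NormedAddCommGroup H] [InnerProductSpace ℂ H]
  [NormedAddCommGroup K] [InnerProductSpace ℂ K]

/-- `(H, μ)` is a Hilbertian algebra, that is, a commutative semigroup object in the symmetric
monoidal category of complex Hilbert spaces. -/
structure IsHilbertianAlgebra (μ : HTensor H H →L[ℂ] H) : Prop where
  assoc : μ ∘L tmap μ (ContinuousLinearMap.id ℂ H) =
    μ ∘L tmap (ContinuousLinearMap.id ℂ H) μ ∘L
      ((tassoc H H H).toContinuousLinearEquiv :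
        HTensor (HTensor H H) H →L[ℂ] HTensor H (HTensor H H))
  comm : μ ∘L tcomm H H = μ

/-- The comultiplication: the Hilbert adjoint of the multiplication. -/
def comul [CompleteSpace H] (μ : HTensor H H →L[ℂ] H) : H →L[ℂ] HTensor H H :=
  ContinuousLinearMap.adjoint μ

/-- The Frobenius condition: both cells of the Frobenius diagram commute. -/
structure IsFrobenius [CompleteSpace H] (μ : HTensor H H →L[ℂ] H) : Prop where
  left : comul μ ∘L μ =
    tmap μ (ContinuousLinearMap.id ℂ H) ∘L
      ((tassoc H H H).symm.toContinuousLinearEquiv :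
        HTensor H (HTensor H H) →L[ℂ] HTensor (HTensor H H) H) ∘L
      tmap (ContinuousLinearMap.id ℂ H) (comul μ)
  right : comul μ ∘L μ =
    tmap (ContinuousLinearMap.id ℂ H) μ ∘L
      ((tassoc H H H).toContinuousLinearEquiv :
        HTensor (HTensor H H) H →L[ℂ] HTensor H (HTensor H H)) ∘L
      tmap (comul μ) (ContinuousLinearMap.id ℂ H)

/-- `(H, μ)` is a (commutative) Hilbertian Frobenius semigroup. -/
structure IsHilbertianFrobenius [CompleteSpace H] (μ : HTensor H H →L[ℂ] H) : Prop
    extends IsHilbertianAlgebra μ, IsFrobenius μ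

/-- The group-like elements: the non-zero `x` with `μ† x = x ⊗ x`. -/
def groupLike [CompleteSpace H] (μ : HTensor H H →L[ℂ] H) : Set H :=
  {x | x ≠ 0 ∧ comul μ x = tmul x x}

/-- `I` is a left ideal of the algebra `H` with product `u v = μ (u ⊗ v)`. -/
def IsLeftIdeal (μ : HTensor H H →L[ℂ] H) (I : Submodule ℂ H) : Prop :=
  ∀ u : H, ∀ v ∈ I, μ (tmul u v) ∈ I

/-- `I` is modular: there is `e` with `u - u e ∈ I` for all `u`. -/
def IsModular (μ : HTensor H H →L[ℂ] H) (I : Submodule ℂ H) : Prop :=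
  ∃ e : H, ∀ u : H, u - μ (tmul u e) ∈ I

/-- `I` is a maximal modular left ideal: a modular left ideal that is maximal among the proper
left ideals. -/
def IsMaximalModularIdeal (μ : HTensor H H →L[ℂ] H) (I : Submodule ℂ H) : Prop :=
  IsModular μ I ∧ Maximal (fun I' : Submodule ℂ H => IsLeftIdeal μ I' ∧ I' ≠ ⊤) I

/-- The Jacobson radical: the intersection of all maximal modular left ideals (it is `H` if there
are none). -/
def jacobson (μ : HTensor H H →L[ℂ] H) : Submodule ℂ H :=
  sInf {I | IsMaximalModularIdeal μ I}

/-- `V` is a subalgebra of `(H, μ)`: a closed subspace such that `μ` maps `V ⊗ V` into `V`. -/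
def IsSubalgebra (μ : HTensor H H →L[ℂ] H) (V : Submodule ℂ H) : Prop :=
  IsClosed (V : Set H) ∧ ∀ t : HTensor V V, μ (tmap V.subtypeL V.subtypeL t) ∈ V

/-- The restriction and co-restriction of the multiplication to a subalgebra. -/
def restrict (μ : HTensor H H →L[ℂ] H) (V : Submodule ℂ H) (hV : IsSubalgebra μ V) :
    HTensor V V →L[ℂ] V :=
  (μ ∘L tmap V.subtypeL V.subtypeL).codRestrict V hV.2

/-- `f` is a morphism of semigroups from `(H, μ)` to `(K, γ)`. -/
def IsSemigroupHom (μ : HTensor H H →L[ℂ] H) (γ : HTensor K K →L[ℂ] K) (f : H →L[ℂ] K) : Prop :=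
  f ∘L μ = γ ∘L tmap f f

/-- `(H, μ)` and `(K, γ)` are unitarily isomorphic as semigroups. -/
def UnitarilyIsomorphic (μ : HTensor H H →L[ℂ] H) (γ : HTensor K K →L[ℂ] K) : Prop :=
  ∃ U : H ≃ₗᵢ[ℂ] K,
    IsSemigroupHom μ γ (U.toContinuousLinearEquiv : H →L[ℂ] K) ∧
    IsSemigroupHom γ μ (U.symm.toContinuousLinearEquiv : K →L[ℂ] H)

end Semigroup

/-! ### Weighted Hilbert spaces -/

/-- A weight on `X`: a map `w : X → [C, ∞)` for some `C > 0`. -/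
structure Weight (X : Type*) where
  /-- the underlying map -/
  toFun : X → ℝ
  bounded_below : ∃ C : ℝ, 0 < C ∧ ∀ x, C ≤ toFun x

instance {X : Type*} : CoeFun (Weight X) (fun _ => X → ℝ) := ⟨Weight.toFun⟩

section Weighted

variable {X : Type*}

theorem Weight.pos (w : Weight X) (x : X) : 0 < w x := by
  obtain ⟨C, hC, h⟩ := w.bounded_below
  exact hC.trans_le (h x)

/-- The functions `f : X → ℂ` with `∑ w(x) |f(x)|² < ∞`, as a subspace of all functions. -/
def weightedSubmodule (w : Weight X) : Submodule ℂ (X → ℂ) where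
  carrier := {f | Summable fun x => w x * ‖f x‖ ^ 2}
  zero_mem' := by simp [summable_zero]
  add_mem' {f g} hf hg := by
    refine Summable.of_nonneg_of_le (fun x => ?_) (fun x => ?_) ((hf.add hg).mul_left 2)
    · exact mul_nonneg (w.pos x).le (sq_nonneg _)
    · have h1 : ‖f x + g x‖ ^ 2 ≤ 2 * (‖f x‖ ^ 2 + ‖g x‖ ^ 2) := by
        nlinarith [norm_add_le (f x) (g x), norm_nonneg (f x + g x), sq_nonneg (‖f x‖ - ‖g x‖),
          norm_nonneg (f x), norm_nonneg (g x)]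
      have := mul_le_mul_of_nonneg_left h1 (w.pos x).le
      simp only [Pi.add_apply]
      linarith
  smul_mem' c f hf := by
    have : (fun x => w x * ‖(c • f) x‖ ^ 2) = fun x => ‖c‖ ^ 2 * (w x * ‖f x‖ ^ 2) := by
      funext x
      simp only [Pi.smul_apply, smul_eq_mul, norm_mul]
      ring
    change Summable fun x => w x * ‖(c • f) x‖ ^ 2
    rw [this]
    exact Summable.mul_left _ hf

/-- The weighted space `ℓ²_w(X)`. -/
def WL2 (w : Weight X) : Type _ := weightedSubmodule w

namespace WL2

variable {w : Weight X}

instance : AddCommGroup (WL2 w) := inferInstanceAs (AddCommGroup (weightedSubmodule w))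
instance : Module ℂ (WL2 w) := inferInstanceAs (Module ℂ (weightedSubmodule w))
/-- The function underlying an element of `ℓ²_w(X)`. -/
def toFun (f : WL2 w) : X → ℂ := (show weightedSubmodule w from f).1

instance : CoeFun (WL2 w) (fun _ => X → ℂ) := ⟨toFun⟩

/-- The element of `ℓ²_w(X)` given by a function with `∑ w(x) |f(x)|² < ∞`. -/
def mk (f : X → ℂ) (hf : Summable fun x => w x * ‖f x‖ ^ 2) : WL2 w := ⟨f, hf⟩

@[simp] theorem mk_apply (f : X → ℂ) (hf : Summable fun x => w x * ‖f x‖ ^ 2) (x : X) :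
    (mk f hf : WL2 w) x = f x := rfl
@[simp] theorem add_apply (f g : WL2 w) (x : X) : (f + g) x = f x + g x := rfl
@[simp] theorem smul_apply (c : ℂ) (f : WL2 w) (x : X) : (c • f) x = c * f x := rfl
@[simp] theorem zero_apply (x : X) : (0 : WL2 w) x = 0 := rfl

@[ext] theorem ext {f g : WL2 w} (h : ∀ x, f x = g x) : f = g := Subtype.ext (funext h)

theorem summable (f : WL2 w) : Summable fun x => w x * ‖f x‖ ^ 2 := f.2

theorem summable_inner (f g : WL2 w) :
    Summable fun x => (w x : ℂ) * (conj (f x) * g x) := by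
  refine Summable.of_norm_bounded (f.summable.add g.summable) (fun x => ?_)
  rw [norm_mul, norm_mul, RCLike.norm_conj, Complex.norm_real, Real.norm_of_nonneg (w.pos x).le,
    ← mul_add]
  refine mul_le_mul_of_nonneg_left ?_ (w.pos x).le
  nlinarith [sq_nonneg (‖f x‖ - ‖g x‖), norm_nonneg (f x), norm_nonneg (g x)]

/-- The inner product `∑ w(x) conj(f(x)) g(x)` of `ℓ²_w(X)`, conjugate-linear in the first
variable. -/
def ip (f g : WL2 w) : ℂ := ∑' x, (w x : ℂ) * (conj (f x) * g x)

theorem ip_self (f : WL2 w) : ip f f = ((∑' x, w x * ‖f x‖ ^ 2 : ℝ) : ℂ) := by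
  rw [ip, Complex.ofReal_tsum]
  refine tsum_congr (fun x => ?_)
  rw [Complex.conj_mul']
  push_cast
  rfl

/-- The inner product space axioms for `ℓ²_w(X)`. -/
@[reducible] def core (w : Weight X) : InnerProductSpace.Core ℂ (WL2 w) where
  inner := ip
  conj_inner_symm f g := by
    rw [ip, ip, Complex.conj_tsum]
    refine tsum_congr (fun x => ?_)
    simp only [map_mul, Complex.conj_ofReal, Complex.conj_conj]
    ring
  re_inner_nonneg f := by
    rw [ip_self]
    exact tsum_nonneg fun x => mul_nonneg (w.pos x).le (sq_nonneg _)
  add_left f g h := by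
    rw [ip, ip, ip, ← (summable_inner f h).tsum_add (summable_inner g h)]
    refine tsum_congr (fun x => ?_)
    simp only [add_apply, map_add]
    ring
  smul_left f g c := by
    rw [ip, ip, ← tsum_mul_left]
    refine tsum_congr (fun x => ?_)
    simp only [smul_apply, map_mul]
    ring
  definite f hf := by
    rw [ip_self, Complex.ofReal_eq_zero] at hf
    have h0 := (hasSum_zero_iff_of_nonneg
      (fun x => mul_nonneg (w.pos x).le (sq_nonneg _))).1 (hf ▸ f.summable.hasSum)
    ext x
    have := congrFun h0 x
    simpa [(w.pos x).ne'] using this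

instance : NormedAddCommGroup (WL2 w) := (core w).toNormedAddCommGroup
instance : InnerProductSpace ℂ (WL2 w) := InnerProductSpace.ofCore (core w).toCore

theorem inner_def (f g : WL2 w) :
    inner ℂ f g = ∑' x, (w x : ℂ) * (conj (f x) * g x) := rfl

theorem norm_sq_eq (f : WL2 w) : ‖f‖ ^ 2 = ∑' x, w x * ‖f x‖ ^ 2 := by
  have h := inner_self_eq_norm_sq_to_K (𝕜 := ℂ) f
  rw [show inner ℂ f f = _ from ip_self f] at h
  exact Complex.ofReal_injective ((Complex.ofReal_pow _ _).trans h.symm)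

/-- The unitary map `f ↦ w^{1/2} f` onto the unweighted space `ℓ²(X)`. -/
def toLp (w : Weight X) : WL2 w ≃ₗᵢ[ℂ] lp (fun _ : X => ℂ) 2 where
  toFun f := ⟨fun x => (Real.sqrt (w x) : ℂ) * f x, by
    refine memℓp_gen ?_
    refine f.summable.congr (fun x => ?_)
    simp only [ENNReal.toReal_ofNat, Real.rpow_two, norm_mul, Complex.norm_real, mul_pow,
      Real.norm_eq_abs, sq_abs, Real.sq_sqrt (w.pos x).le]⟩
  map_add' f g := by
    ext x
    exact mul_add _ _ _
  map_smul' c f := by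
    ext x
    exact mul_left_comm _ _ _
  invFun g := mk (fun x => (Real.sqrt (w x) : ℂ)⁻¹ * g x) (by
    have := (lp.memℓp g).summable (by norm_num)
    refine this.congr (fun x => ?_)
    have hw := w.pos x
    simp only [ENNReal.toReal_ofNat, Real.rpow_two, norm_mul, norm_inv, Complex.norm_real, mul_pow,
      Real.norm_eq_abs, inv_pow, sq_abs, Real.sq_sqrt hw.le]
    field_simp)
  left_inv f := by
    ext x
    have : (Real.sqrt (w x) : ℂ) ≠ 0 := by
      exact_mod_cast (Real.sqrt_pos.2 (w.pos x)).ne'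
    exact inv_mul_cancel_left₀ this _
  right_inv g := by
    ext x
    have : (Real.sqrt (w x) : ℂ) ≠ 0 := by
      exact_mod_cast (Real.sqrt_pos.2 (w.pos x)).ne'
    exact mul_inv_cancel_left₀ this _
  norm_map' f := by
    refine (sq_eq_sq₀ (norm_nonneg _) (norm_nonneg _)).1 ?_
    have key : ∀ g : lp (fun _ : X => ℂ) 2, ‖g‖ ^ 2 = ∑' x, ‖g x‖ ^ 2 := fun g => by
      simpa using lp.norm_rpow_eq_tsum (p := 2) (by norm_num) g
    rw [norm_sq_eq]
    refine (key _).trans (tsum_congr (fun x => ?_))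
    change ‖(Real.sqrt (w x) : ℂ) * f x‖ ^ 2 = _
    simp only [norm_mul, Complex.norm_real, mul_pow, Real.norm_eq_abs, sq_abs,
      Real.sq_sqrt (w.pos x).le]

instance : CompleteSpace (WL2 w) :=
  (completeSpace_congr (e := (toLp w).toEquiv) (toLp w).isometry.isUniformEmbedding).2
    inferInstance

theorem norm_apply_sq_le (f : WL2 w) (x : X) : w x * ‖f x‖ ^ 2 ≤ ‖f‖ ^ 2 := by
  rw [norm_sq_eq]
  exact f.summable.le_tsum x (fun y _ => mul_nonneg (w.pos y).le (sq_nonneg _))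

theorem summable_mul (f g : WL2 w) : Summable fun x => w x * ‖f x * g x‖ ^ 2 := by
  obtain ⟨C, hC, hw⟩ := w.bounded_below
  refine Summable.of_nonneg_of_le (fun x => mul_nonneg (w.pos x).le (sq_nonneg _)) (fun x => ?_)
    (f.summable.mul_right (‖g‖ ^ 2 / C))
  have h1 : ‖g x‖ ^ 2 ≤ ‖g‖ ^ 2 / C := by
    rw [le_div_iff₀ hC]
    nlinarith [norm_apply_sq_le g x, hw x, sq_nonneg ‖g x‖]
  rw [norm_mul, mul_pow, ← mul_assoc]
  exact mul_le_mul_of_nonneg_left h1 (mul_nonneg (w.pos x).le (sq_nonneg _))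

/-- Pointwise multiplication on `ℓ²_w(X)` as a bilinear map. -/
def mulBilin (w : Weight X) : WL2 w →ₗ[ℂ] WL2 w →ₗ[ℂ] WL2 w :=
  LinearMap.mk₂ ℂ (fun f g => mk (fun x => f x * g x) (summable_mul f g))
    (fun f f' g => by ext x; exact add_mul _ _ _)
    (fun c f g => by ext x; exact mul_assoc _ _ _)
    (fun f g g' => by ext x; exact mul_add _ _ _)
    (fun c f g => by ext x; exact mul_left_comm _ _ _)

/-- The linear map `f ⊗ g ↦ f g` on the algebraic tensor product. -/
def mulAlg (w : Weight X) : WL2 w ⊗[ℂ] WL2 w →ₗ[ℂ] WL2 w := TensorProduct.lift (mulBilin w)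

open scoped Classical in
/-- The unit vector `δ_x / w(x)^{1/2}`. -/
def unitVec (w : Weight X) (x : X) : WL2 w :=
  mk (Pi.single x ((Real.sqrt (w x) : ℂ)⁻¹)) (by
    refine summable_of_ne_finset_zero (s := {x}) (fun y hy => ?_)
    rw [Pi.single_eq_of_ne (by simpa using hy)]
    simp)

open scoped Classical in
theorem inner_unitVec (x : X) (f : WL2 w) :
    inner ℂ (unitVec w x) f = (Real.sqrt (w x) : ℂ) * f x := by
  have hw : (Real.sqrt (w x) : ℂ) ≠ 0 := by
    exact_mod_cast (Real.sqrt_pos.2 (w.pos x)).ne'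
  have hw2 : (w x : ℂ) = (Real.sqrt (w x) : ℂ) * (Real.sqrt (w x) : ℂ) := by
    exact_mod_cast (Real.mul_self_sqrt (w.pos x).le).symm
  rw [inner_def, tsum_eq_single x]
  · simp only [unitVec, mk_apply, Pi.single_eq_same, map_inv₀, Complex.conj_ofReal]
    rw [hw2]
    field_simp
  · intro y hy
    simp [unitVec, Pi.single_eq_of_ne hy]

theorem orthonormal_unitVec (w : Weight X) : Orthonormal ℂ (unitVec w) := by
  classical
  rw [orthonormal_iff_ite]
  intro x y
  have hw : (Real.sqrt (w x) : ℂ) ≠ 0 := by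
    exact_mod_cast (Real.sqrt_pos.2 (w.pos x)).ne'
  rw [inner_unitVec]
  by_cases h : x = y
  · subst h
    simp [unitVec, hw]
  · simp [unitVec, h]

theorem orthonormal_unitVec_tmul (w : Weight X) :
    Orthonormal ℂ (fun x => unitVec w x ⊗ₜ[ℂ] unitVec w x) := by
  classical
  have h := orthonormal_iff_ite.1 (orthonormal_unitVec w)
  rw [orthonormal_iff_ite]
  intro x y
  rw [TensorProduct.inner_tmul, h]
  split_ifs <;> simp

theorem inner_unitVec_tmul (x : X) (t : WL2 w ⊗[ℂ] WL2 w) :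
    inner ℂ (unitVec w x ⊗ₜ[ℂ] unitVec w x) t = (w x : ℂ) * mulAlg w t x := by
  have hw2 : (w x : ℂ) = (Real.sqrt (w x) : ℂ) * (Real.sqrt (w x) : ℂ) := by
    exact_mod_cast (Real.mul_self_sqrt (w.pos x).le).symm
  induction t with
  | zero => simp
  | add a b ha hb => rw [inner_add_right, ha, hb, map_add, add_apply, mul_add]
  | tmul f g =>
    rw [TensorProduct.inner_tmul, inner_unitVec, inner_unitVec, hw2]
    change _ = _ * (f x * g x)
    ring

theorem exists_bound_mulAlg (w : Weight X) : ∃ M : ℝ, ∀ t, ‖mulAlg w t‖ ≤ M * ‖t‖ := by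
  obtain ⟨C, hC, hw⟩ := w.bounded_below
  refine ⟨Real.sqrt (1 / C), fun t => ?_⟩
  refine (sq_le_sq₀ (norm_nonneg _) (by positivity)).1 ?_
  rw [mul_pow, Real.sq_sqrt (by positivity), norm_sq_eq]
  have hb := (orthonormal_unitVec_tmul w).tsum_inner_products_le (x := t)
  have hs := (orthonormal_unitVec_tmul w).inner_products_summable (x := t)
  refine le_trans ?_ (mul_le_mul_of_nonneg_left hb (by positivity))
  rw [← tsum_mul_left]
  refine (mulAlg w t).summable.tsum_le_tsum (fun x => ?_) (hs.mul_left _)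
  rw [inner_unitVec_tmul, norm_mul, mul_pow, Complex.norm_real, Real.norm_eq_abs, sq_abs,
    ← mul_assoc]
  refine mul_le_mul_of_nonneg_right ?_ (sq_nonneg _)
  rw [div_mul_eq_mul_div, one_mul, le_div_iff₀ hC]
  nlinarith [hw x, w.pos x]

/-- The bounded linear multiplication of `ℓ²_w(X)`, with `f ⊗ g ↦ f g` (pointwise product). -/
def mul (w : Weight X) : HTensor (WL2 w) (WL2 w) →L[ℂ] WL2 w :=
  tlift ((mulAlg w).mkContinuousOfExistsBound (exists_bound_mulAlg w))

theorem mul_tmul (f g : WL2 w) (x : X) : mul w (tmul f g) x = f x * g x := by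
  rw [mul, tmul, tlift_incl]
  rfl

end WL2

end Weighted

end HilbFrob
end

/-! Write M_u for multiplication by u. The Frobenius condition says that M_u† is again a multiplier,
so with commutativity every M_u commutes with every M_v†; in particular each M_u is normal. Moreover
M_v† M_v is compact: it is the square of the conjugate-linear operator u ↦ M_u† v, obtained by
contracting the tensor μ†(v), and contraction against a Hilbertian tensor is a norm limit of
finite-rank operators.

Group-like elements are the Riesz vectors of the nonzero bounded characters u ↦ ⟨x, u⟩. Normality
makes each of them a joint eigenvector of all the M_u, and distinct ones are orthogonal.

The crux is that H annihilates G^⊥ (`mulL_eq_zero_of_mem_orthogonal`). If some M_v were nonzero on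
G^⊥, then M_v† M_v would have there a nonzero eigenvalue with a finite-dimensional eigenspace,
stable under the commuting M_u. A joint eigenvector in it yields a character whose Riesz vector is
group-like but not orthogonal to that eigenvector, a contradiction.

Hence J = G^⊥ (`jacobson_eq`): kernels of characters are maximal modular ideals, and an element
annihilated by H lies in every modular ideal. The normalized group-likes then form a Hilbert basis
of J^⊥, and u ↦ (⟨x, u⟩)_x is the required unitary; it is multiplicative because each coordinate is
a character. -/

open ContinuousLinearMap (adjoint)

noncomputable section

namespace HilbFrob

/-! ### Contraction against a Hilbertian tensor -/

section Tensor

variable {H K L : Type*}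
  [NormedAddCommGroup H] [InnerProductSpace ℂ H]
  [NormedAddCommGroup K] [InnerProductSpace ℂ K]
  [NormedAddCommGroup L] [InnerProductSpace ℂ L]

theorem norm_tmul (x : H) (y : K) : ‖tmul x y‖ = ‖x‖ * ‖y‖ := by
  simp [tmul]

/-- Bounded linear maps on a Hilbertian tensor product agree if they agree on elementary
tensors. -/
theorem clm_ext_tmul {f g : HTensor H K →L[ℂ] L}
    (h : ∀ x y, f (tmul x y) = g (tmul x y)) : f = g := by
  ext t
  refine denseRange_incl.induction_on (p := fun t => f t = g t) t
    (isClosed_eq f.continuous g.continuous) fun a => ?_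
  induction a with
  | zero => simp
  | add a b ha hb => simp only [map_add, ha, hb]
  | tmul x y => exact h x y

/-- A closed subspace of a Hilbertian tensor product containing all elementary tensors is
everything. -/
theorem mem_of_forall_tmul_mem {V : Submodule ℂ (HTensor H K)}
    (hV : IsClosed (V : Set (HTensor H K))) (h : ∀ x y, tmul x y ∈ V) (t : HTensor H K) :
    t ∈ V := by
  refine denseRange_incl.induction_on (p := fun t => t ∈ V) t hV fun a => ?_
  induction a with
  | zero => simp
  | add a b ha hb => simpa only [map_add] using V.add_mem ha hb
  | tmul x y => exact h x y

/-- The bounded linear map `y ↦ x ⊗ y`. -/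
def tmulL (K : Type*) [NormedAddCommGroup K] [InnerProductSpace ℂ K] (x : H) :
    K →L[ℂ] HTensor H K :=
  ((incl H K).toLinearMap ∘ₗ TensorProduct.mk ℂ H K x).mkContinuous ‖x‖
    fun y => (norm_tmul x y).le

@[simp] theorem tmulL_apply (x : H) (y : K) : tmulL K x y = tmul x y := rfl

theorem tmul_add_left (x x' : H) (y : K) : tmul (x + x') y = tmul x y + tmul x' y := by
  simp [tmul, TensorProduct.add_tmul]

theorem tmul_smul_left (c : ℂ) (x : H) (y : K) : tmul (c • x) y = c • tmul x y := by
  rw [tmul, ← TensorProduct.smul_tmul', map_smul, tmul]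

variable [CompleteSpace K]

theorem inner_adjoint_tmulL (x : H) (y : K) (t : HTensor H K) :
    inner ℂ y (adjoint (tmulL K x) t) = inner ℂ (tmul x y) t := by
  rw [ContinuousLinearMap.adjoint_inner_right, tmulL_apply]

/-- The conjugate-linear operator `x ↦ (⟨x| ⊗ id) t` attached to `t : H ⊗ K`. -/
def contraction (H K : Type*) [NormedAddCommGroup H] [InnerProductSpace ℂ H]
    [NormedAddCommGroup K] [InnerProductSpace ℂ K] [CompleteSpace K] :
    HTensor H K →L[ℂ] H →L⋆[ℂ] K :=
  LinearMap.mkContinuous₂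
    (LinearMap.mk₂'ₛₗ (RingHom.id ℂ) (starRingEnd ℂ) (fun t x => adjoint (tmulL K x) t)
      (fun s t x => map_add _ _ _)
      (fun c t x => map_smul _ _ _)
      (fun t x x' => ext_inner_left ℂ fun y => by
        simp only [inner_add_right, inner_adjoint_tmulL, tmul_add_left, inner_add_left])
      (fun c t x => ext_inner_left ℂ fun y => by
        simp only [inner_smul_right, inner_adjoint_tmulL, tmul_smul_left, inner_smul_left]))
    1 fun t x => by
      refine ((adjoint (tmulL K x)).le_opNorm t).trans ?_
      rw [LinearIsometryEquiv.norm_map, one_mul, mul_comm]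
      gcongr
      exact LinearMap.mkContinuous_norm_le _ (norm_nonneg x) _

theorem contraction_apply (t : HTensor H K) (x : H) :
    contraction H K t x = adjoint (tmulL K x) t := rfl

theorem contraction_tmul (a x : H) (b : K) :
    contraction H K (tmul a b) x = inner ℂ x a • b :=
  ext_inner_left ℂ fun y => by
    rw [contraction_apply, inner_adjoint_tmulL, inner_tmul, inner_smul_right]

/-- An elementary tensor gives a rank-one operator. Compact operators form a norm-closed subspace
and the contraction depends continuously on t, so density of the elementary tensors suffices. -/
theorem isCompactOperator_contraction (t : HTensor H K) :
    IsCompactOperator (contraction H K t) := by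
  let V : Submodule ℂ (HTensor H K) :=
    (compactOperator (starRingEnd ℂ) H K).comap (contraction H K).toLinearMap
  have hV : IsClosed (V : Set (HTensor H K)) :=
    isClosed_setOfPred_isCompactOperator.preimage (contraction H K).continuous
  refine mem_of_forall_tmul_mem (V := V) hV (fun a b => ?_) t
  change IsCompactOperator (contraction H K (tmul a b))
  have h : IsCompactOperator (fun c : ℂ => c • b) :=
    isCompactOperator_of_locallyCompactSpace_rng (ContinuousLinearMap.toSpanSingleton ℂ b)
  suffices e : ⇑(contraction H K (tmul a b)) = (fun c : ℂ => c • b) ∘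
      ((starL ℂ : ℂ ≃L⋆[ℂ] ℂ).toContinuousLinearMap.comp (innerSL ℂ a)) by
    rw [e]
    exact h.comp_clm _
  funext x
  simp [contraction_tmul]

end Tensor

/-! ### Multiplication operators and their adjoints -/

section Multiplication

variable {H : Type*} [NormedAddCommGroup H] [InnerProductSpace ℂ H]
  {μ : HTensor H H →L[ℂ] H}

/-- The operator of multiplication by `u`. -/
def mulL (μ : HTensor H H →L[ℂ] H) (u : H) : H →L[ℂ] H := μ ∘L tmulL H u

theorem mulL_apply (u v : H) : mulL μ u v = μ (tmul u v) := rfl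

theorem IsHilbertianAlgebra.mulL_comm (hμ : IsHilbertianAlgebra μ) (u v : H) :
    mulL μ u v = mulL μ v u := by
  have := DFunLike.congr_fun hμ.comm (tmul u v)
  rw [ContinuousLinearMap.comp_apply, tcomm_tmul] at this
  exact this.symm

theorem IsHilbertianAlgebra.mulL_mul (hμ : IsHilbertianAlgebra μ) (u v w : H) :
    mulL μ (mulL μ u v) w = mulL μ u (mulL μ v w) := by
  have := DFunLike.congr_fun hμ.assoc (tmul (tmul u v) w)
  simpa [tmap_tmul, tassoc_tmul, mulL_apply] using this

theorem IsHilbertianAlgebra.mulL_mulL_comm (hμ : IsHilbertianAlgebra μ) (u v w : H) :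
    mulL μ u (mulL μ v w) = mulL μ v (mulL μ u w) := by
  rw [← hμ.mulL_mul, hμ.mulL_comm u v, hμ.mulL_mul]

variable [CompleteSpace H]

theorem inner_tmul_comul (u v w : H) :
    inner ℂ (tmul u v) (comul μ w) = inner ℂ (mulL μ u v) w := by
  rw [comul, ContinuousLinearMap.adjoint_inner_right, mulL_apply]

/-- This is the left Frobenius cell evaluated at u ⊗ v: with u fixed, reassociating and multiplying
acts only on the first leg of μ†(v). -/
theorem IsFrobenius.comul_mulL (hμ : IsFrobenius μ) (u v : H) :
    comul μ (mulL μ u v) = tmap (mulL μ u) (.id ℂ H) (comul μ v) := by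
  have h := DFunLike.congr_fun hμ.left (tmul u v)
  have key : (tmap μ (.id ℂ H) ∘L ((tassoc H H H).symm.toContinuousLinearEquiv :
      HTensor H (HTensor H H) →L[ℂ] HTensor (HTensor H H) H)) ∘L tmulL (HTensor H H) u
      = tmap (mulL μ u) (.id ℂ H) := clm_ext_tmul fun x y => by
    have : (tassoc H H H).symm (tmul u (tmul x y)) = tmul (tmul u x) y := by
      rw [LinearIsometryEquiv.symm_apply_eq, tassoc_tmul]
    simp [this, tmap_tmul, mulL_apply]
  rw [← key]
  simpa [tmap_tmul, mulL_apply] using h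

/-- The adjoint of a multiplication operator is a multiplier. -/
theorem IsFrobenius.adjoint_mulL_mul (hμ : IsFrobenius μ) (u v w : H) :
    adjoint (mulL μ u) (mulL μ v w) = mulL μ (adjoint (mulL μ u) v) w := by
  have key : innerSL ℂ (tmul v w) ∘L tmap (mulL μ u) (.id ℂ H)
      = innerSL ℂ (tmul (adjoint (mulL μ u) v) w) := clm_ext_tmul fun x y => by
    simp [tmap_tmul, inner_tmul, ContinuousLinearMap.adjoint_inner_left]
  refine ext_inner_right ℂ fun z => ?_
  rw [ContinuousLinearMap.adjoint_inner_left, ← inner_tmul_comul, hμ.comul_mulL,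
    ← inner_tmul_comul]
  exact DFunLike.congr_fun key (comul μ z)

variable (hμ : IsHilbertianFrobenius μ)
include hμ

/-- Multiplication operators commute with the adjoints of multiplication operators. -/
theorem IsHilbertianFrobenius.adjoint_mulL_mulL (u v w : H) :
    adjoint (mulL μ u) (mulL μ v w) = mulL μ v (adjoint (mulL μ u) w) := by
  rw [hμ.mulL_comm v w, hμ.adjoint_mulL_mul, hμ.mulL_comm]

/-- M_u is normal, so M_u and M_u† have the same kernel. -/
theorem IsHilbertianFrobenius.adjoint_mulL_eq_zero_iff (u v : H) :
    adjoint (mulL μ u) v = 0 ↔ mulL μ u v = 0 := by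
  rw [← inner_self_eq_zero (𝕜 := ℂ), ← inner_self_eq_zero (𝕜 := ℂ) (x := mulL μ u v),
    ContinuousLinearMap.adjoint_inner_left, ← hμ.adjoint_mulL_mulL,
    ContinuousLinearMap.adjoint_inner_right]

/-- The operator `M_v† M_v`, where `M_v` is multiplication by `v`, is compact. -/
theorem IsHilbertianFrobenius.isCompactOperator_adjoint_mulL_comp (v : H) :
    IsCompactOperator (adjoint (mulL μ v) ∘L mulL μ v) := by
  have hc : ∀ u, contraction H H (comul μ v) u = adjoint (mulL μ u) v := fun u => by
    rw [contraction_apply, comul, mulL, ContinuousLinearMap.adjoint_comp]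
    rfl
  have h := (isCompactOperator_contraction (comul μ v)).clm_comp (contraction H H (comul μ v))
  -- Paired with y, both sides equal ⟨vy, vu⟩. On the right this requires moving M_y past M_u†.
  suffices e : ⇑(adjoint (mulL μ v) ∘L mulL μ v) =
      contraction H H (comul μ v) ∘ contraction H H (comul μ v) by rwa [e]
  funext u
  refine ext_inner_left ℂ fun y => ?_
  rw [Function.comp_apply, hc, hc, ContinuousLinearMap.comp_apply,
    ContinuousLinearMap.adjoint_inner_right, ContinuousLinearMap.adjoint_inner_right,
    hμ.mulL_comm (adjoint (mulL μ u) v) y, ← hμ.adjoint_mulL_mulL,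
    ContinuousLinearMap.adjoint_inner_left, hμ.mulL_comm v u, hμ.mulL_comm v y]

end Multiplication

/-! ### Joint eigenvectors of commuting operators -/

/-- A nonzero finite-dimensional subspace invariant under a commuting family of operators contains
a joint eigenvector. -/
theorem exists_joint_eigenvector {ι V : Type*} [AddCommGroup V] [Module ℂ V] (T : ι → V →ₗ[ℂ] V)
    (hT : ∀ i j v, T i (T j v) = T j (T i v)) (F : Submodule ℂ V) [FiniteDimensional ℂ F]
    (hF : F ≠ ⊥) (hinv : ∀ i, ∀ v ∈ F, T i v ∈ F) :
    ∃ x ∈ F, x ≠ 0 ∧ ∀ i, ∃ c : ℂ, T i x = c • x := by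
  induction h : Module.finrank ℂ F using Nat.strong_induction_on generalizing F with
  | _ n ih =>
  obtain ⟨x, hxF, hx⟩ := F.ne_bot_iff.1 hF
  by_cases hall : ∀ i, ∃ c : ℂ, T i x = c • x
  · exact ⟨x, hxF, hx, hall⟩
  push Not at hall
  obtain ⟨i, hi⟩ := hall
  have : Nontrivial F := Submodule.nontrivial_iff_ne_bot.2 hF
  obtain ⟨c, hc⟩ := Module.End.exists_eigenvalue ((T i).restrict (hinv i))
  obtain ⟨e, he⟩ := hc.exists_hasEigenvector
  -- This eigenspace is stable under the family by commutation, and is proper because x is not an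
  -- eigenvector of `T i`; so the dimension drops.
  let F' : Submodule ℂ V := F ⊓ Module.End.eigenspace (T i) c
  have hle : F' < F := lt_of_le_of_ne inf_le_left fun hEq =>
    hi c (Module.End.mem_eigenspace_iff.1 (hEq.ge hxF).2)
  have : FiniteDimensional ℂ F' := Submodule.finiteDimensional_of_le hle.le
  obtain ⟨y, hy, hy0, hy'⟩ := ih _ (h ▸ Submodule.finrank_lt_finrank_of_lt hle) F'
    (F'.ne_bot_iff.2 ⟨e, ⟨e.2, Module.End.mem_eigenspace_iff.2
      (congrArg Subtype.val he.apply_eq_smul)⟩, fun h0 => he.2 (Subtype.ext h0)⟩)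
    (fun j v hv => ⟨hinv j v hv.1, Module.End.mem_eigenspace_iff.2 (by
      rw [hT, Module.End.mem_eigenspace_iff.1 hv.2, map_smul])⟩) rfl
  exact ⟨y, hy.1, hy0, hy'⟩

/-- Let `S` be a compact self-adjoint operator and `T` a commuting family of operators commuting
with `S`. A closed subspace invariant under all of them on which `S` does not vanish contains a
joint eigenvector with a nonzero eigenvalue for `S`. -/
theorem exists_joint_eigenvector_of_isCompactOperator {ι E : Type*} [NormedAddCommGroup E]
    [InnerProductSpace ℂ E] {S : E →L[ℂ] E} (hS : IsCompactOperator S) (hS' : S.IsSymmetric)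
    (K : Submodule ℂ E) [CompleteSpace K] (hSK : ∀ k ∈ K, S k ∈ K) (T : ι → E →ₗ[ℂ] E)
    (hT : ∀ i j x, T i (T j x) = T j (T i x)) (hST : ∀ i x, S (T i x) = T i (S x))
    (hTK : ∀ i, ∀ k ∈ K, T i k ∈ K) {u : E} (hu : u ∈ K) (hSu : S u ≠ 0) :
    ∃ x ∈ K, x ≠ 0 ∧ (∃ c : ℂ, c ≠ 0 ∧ S x = c • x) ∧ ∀ i, ∃ c : ℂ, T i x = c • x := by
  let SK : K →L[ℂ] K := S.restrict hSK
  have hSKc : IsCompactOperator SK := hS.restrict' (f := S.toLinearMap) hSK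
  have hSKs : SK.IsSymmetric := hS'.restrict_invariant hSK
  -- A compact symmetric operator on a Hilbert space with no nonzero eigenvalue vanishes, but the
  -- restriction of S does not vanish at u.
  have hne : ¬ ∀ c, Module.End.HasEigenvalue (SK : Module.End ℂ K) c → c = 0 := fun h => by
    have h0 := (ContinuousLinearMap.eq_zero_of_forall_hasEigenvalue_eq_zero hSKc hSKs).1 h
    have h1 : SK ⟨u, hu⟩ = 0 := by rw [h0, zero_apply]
    exact hSu (congrArg Subtype.val h1)
  push Not at hne
  obtain ⟨c, hc, hc0⟩ := hne
  have := ContinuousLinearMap.finite_dimensional_eigenspace hSKc c hc0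
  let F : Submodule ℂ E := (Module.End.eigenspace SK.toLinearMap c).map K.subtype
  have hFmem : ∀ z, z ∈ F ↔ z ∈ K ∧ S z = c • z := fun z => by
    constructor
    · rintro ⟨k, hk, rfl⟩
      exact ⟨k.2, congrArg Subtype.val (Module.End.mem_eigenspace_iff.1 hk)⟩
    · rintro ⟨hz, hz'⟩
      exact ⟨⟨z, hz⟩, Module.End.mem_eigenspace_iff.2 (Subtype.ext hz'), rfl⟩
  obtain ⟨e, he⟩ := hc.exists_hasEigenvector
  obtain ⟨x, hxF, hx, hχ⟩ := exists_joint_eigenvector T hT F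
    (F.ne_bot_iff.2 ⟨e, ⟨e, he.1, rfl⟩, fun h0 => he.2 (Subtype.ext h0)⟩)
    (fun i z hz => by
      rw [hFmem] at hz ⊢
      exact ⟨hTK i z hz.1, by rw [hST, hz.2, map_smul]⟩)
  exact ⟨x, ((hFmem x).1 hxF).1, hx, ⟨c, hc0, ((hFmem x).1 hxF).2⟩, hχ⟩

/-! ### Group-like elements and the Jacobson radical -/

section GroupLike

variable {H : Type*} [NormedAddCommGroup H] [InnerProductSpace ℂ H] [CompleteSpace H]
  {μ : HTensor H H →L[ℂ] H}

/-- A nonzero vector is group-like if and only if it represents a multiplicative functional. -/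
theorem mem_groupLike_iff {x : H} :
    x ∈ groupLike μ ↔
      x ≠ 0 ∧ ∀ u v, inner ℂ x (mulL μ u v) = inner ℂ x u * inner ℂ x v := by
  refine and_congr_right fun _ => ⟨fun hx u v => ?_, fun h => ?_⟩
  · rw [← inner_tmul, ← hx, mulL_apply, comul, ContinuousLinearMap.adjoint_inner_left]
  · have key : innerSL ℂ (comul μ x) = innerSL ℂ (tmul x x) := clm_ext_tmul fun u v => by
      rw [innerSL_apply_apply, innerSL_apply_apply, inner_tmul, ← h, mulL_apply, comul,
        ContinuousLinearMap.adjoint_inner_left]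
    exact ext_inner_right ℂ fun t => DFunLike.congr_fun key t

theorem adjoint_mulL_of_mem_groupLike {x : H} (hx : x ∈ groupLike μ) (u : H) :
    adjoint (mulL μ u) x = inner ℂ u x • x :=
  ext_inner_right ℂ fun v => by
    rw [ContinuousLinearMap.adjoint_inner_left, (mem_groupLike_iff.1 hx).2, inner_smul_left,
      inner_conj_symm]

/-- ‖x‖² = ‖x ⊗ x‖ = ‖μ†(x)‖ ≤ ‖μ‖ ‖x‖, as the adjoint preserves the operator norm. -/
theorem norm_le_of_mem_groupLike {x : H} (hx : x ∈ groupLike μ) : ‖x‖ ≤ ‖μ‖ := by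
  have h := (comul μ).le_opNorm x
  rw [hx.2, norm_tmul, comul, LinearIsometryEquiv.norm_map] at h
  exact le_of_mul_le_mul_right h (norm_pos_iff.2 hx.1)

theorem mem_span_groupLike_orthogonal_iff {u : H} :
    u ∈ (Submodule.span ℂ (groupLike μ))ᗮ ↔ ∀ x ∈ groupLike μ, inner ℂ x u = 0 := by
  refine ⟨fun h x hx => h x (Submodule.subset_span hx), fun h y hy => ?_⟩
  induction hy using Submodule.span_induction with
  | mem x hx => exact h x hx
  | zero => exact inner_zero_left _
  | add a b _ _ ha hb => rw [inner_add_left, ha, hb, add_zero]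
  | smul c a _ ha => rw [inner_smul_left, ha, mul_zero]

/-- The kernel of the character represented by a group-like element is a maximal modular ideal. -/
theorem isMaximalModularIdeal_of_mem_groupLike {x : H}
    (hx : x ∈ groupLike μ) : IsMaximalModularIdeal μ (innerSL ℂ x).ker := by
  have hxx : inner ℂ x x ≠ 0 := inner_self_ne_zero.2 hx.1
  have hmul := (mem_groupLike_iff.1 hx).2
  have hmem : ∀ u, u ∈ (innerSL ℂ x).ker ↔ inner ℂ x u = 0 := fun u => Iff.rfl
  -- The modular unit is a vector on which the character ⟨x, ·⟩ takes the value 1.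
  refine ⟨⟨(inner ℂ x x)⁻¹ • x, fun u => ?_⟩, ⟨fun u v hv => ?_, fun h => ?_⟩, ?_⟩
  · rw [hmem, inner_sub_right, ← mulL_apply, hmul, inner_smul_right]
    field_simp
    ring
  · rw [hmem] at hv ⊢
    rw [← mulL_apply, hmul, hv, mul_zero]
  · exact hxx ((hmem x).1 (h ▸ Submodule.mem_top))
  · rintro I ⟨-, hI⟩ hle
    by_contra hnot
    obtain ⟨z, hzI, hz⟩ := SetLike.not_le_iff_exists.1 hnot
    rw [hmem] at hz
    refine hI (eq_top_iff.2 fun u _ => ?_)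
    have h : u - (inner ℂ x u / inner ℂ x z) • z ∈ I := hle ((hmem _).2 (by
      rw [inner_sub_right, inner_smul_right]
      field_simp
      ring))
    simpa using I.add_mem h (I.smul_mem (inner ℂ x u / inner ℂ x z) hzI)

variable (hμ : IsHilbertianFrobenius μ)
include hμ

/-- A normal operator and its adjoint share eigenvectors, with conjugate eigenvalues. The defect y
lies in the same eigenspace of M_u† as x, and this forces ⟨y, y⟩ = 0. -/
theorem IsHilbertianFrobenius.mulL_of_mem_groupLike {x : H} (hx : x ∈ groupLike μ) (u : H) :
    mulL μ u x = inner ℂ x u • x := by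
  set y := mulL μ u x - inner ℂ x u • x with hy
  have h : adjoint (mulL μ u) y = inner ℂ u x • y := by
    rw [hy, map_sub, hμ.adjoint_mulL_mulL, map_smul, adjoint_mulL_of_mem_groupLike hx, map_smul,
      smul_sub, smul_comm]
  refine sub_eq_zero.1 ((inner_self_eq_zero (𝕜 := ℂ)).1 ?_)
  rw [← hy]
  nth_rewrite 1 [hy]
  rw [inner_sub_left, ← ContinuousLinearMap.adjoint_inner_right, h, inner_smul_left,
    inner_smul_right, inner_conj_symm, sub_self]

/-- Computing xy in both orders gives ⟨y, x⟩ y = ⟨x, y⟩ x. If the coefficients were nonzero, pairing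
with x would make both equal to ⟨x, x⟩, whence x = y. -/
theorem IsHilbertianFrobenius.inner_eq_zero_of_mem_groupLike {x y : H} (hx : x ∈ groupLike μ)
    (hy : y ∈ groupLike μ) (hxy : x ≠ y) : inner ℂ x y = 0 := by
  by_contra h
  have e : inner ℂ y x • y = inner ℂ x y • x := by
    rw [← hμ.mulL_of_mem_groupLike hx, ← hμ.mulL_of_mem_groupLike hy, hμ.mulL_comm]
  have h1 : inner ℂ y x = inner ℂ x x := by
    have := congrArg (inner ℂ x) e
    rw [inner_smul_right, inner_smul_right, mul_comm] at this
    exact mul_left_cancel₀ h this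
  have h2 : inner ℂ x y = inner ℂ x x := by
    rw [← inner_conj_symm x y, h1, inner_conj_symm]
  rw [h1, h2] at e
  exact hxy (smul_right_injective H (h2 ▸ h) e).symm

/-- A joint eigenvector of the multiplication operators, not annihilated by all of them, is not
orthogonal to all group-like elements. -/
theorem IsHilbertianFrobenius.exists_groupLike_of_joint_eigenvector {x : H} (hx : x ≠ 0)
    {χ : H → ℂ} (hχ : ∀ u, mulL μ u x = χ u • x) {v : H} (hv : χ v ≠ 0) :
    ∃ g ∈ groupLike μ, inner ℂ g x ≠ 0 := by
  have hxx : inner ℂ x x ≠ 0 := inner_self_ne_zero.2 hx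
  -- The Riesz vector of χ: ⟨M_x† x, u⟩ = ⟨x, xu⟩ = χ(u) ⟨x, x⟩.
  let g : H := (inner ℂ x x)⁻¹ • adjoint (mulL μ x) x
  have hg : ∀ u, inner ℂ g u = χ u := fun u => by
    rw [inner_smul_left, ContinuousLinearMap.adjoint_inner_left, hμ.mulL_comm, hχ,
      inner_smul_right, map_inv₀, inner_conj_symm]
    field_simp
  have hg0 : g ≠ 0 := fun h => hv (by rw [← hg, h, inner_zero_left])
  refine ⟨g, mem_groupLike_iff.2 ⟨hg0, fun u w => ?_⟩, fun h => hg0 ?_⟩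
  · rw [hg, hg, hg]
    refine smul_left_injective ℂ hx ?_
    change χ (mulL μ u w) • x = (χ u * χ w) • x
    rw [← hχ, hμ.mulL_mul, hχ, map_smul, hχ, smul_smul, mul_comm]
  -- Here χ(x) = 0, so M_x x = 0, and normality gives M_x† x = 0.
  · rw [hg] at h
    have : adjoint (mulL μ x) x = 0 := by
      rw [hμ.adjoint_mulL_eq_zero_iff, hχ, h, zero_smul]
    exact (congrArg _ this).trans (smul_zero _)

/-- A vector orthogonal to all group-like elements is annihilated by `H`. -/
theorem IsHilbertianFrobenius.mulL_eq_zero_of_mem_orthogonal {u : H}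
    (hu : u ∈ (Submodule.span ℂ (groupLike μ))ᗮ) (v : H) : mulL μ v u = 0 := by
  set K := (Submodule.span ℂ (groupLike μ))ᗮ with hK
  set S := adjoint (mulL μ v) ∘L mulL μ v with hS
  -- Group-likes are eigenvectors of every M_a† and every M_a, so their orthogonal complement is
  -- stable under both.
  have hmul : ∀ a, ∀ k ∈ K, mulL μ a k ∈ K := fun a k hk => by
    rw [mem_span_groupLike_orthogonal_iff] at hk ⊢
    intro x hx
    rw [← ContinuousLinearMap.adjoint_inner_left, adjoint_mulL_of_mem_groupLike hx,
      inner_smul_left, hk x hx, mul_zero]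
  have hadj : ∀ a, ∀ k ∈ K, adjoint (mulL μ a) k ∈ K := fun a k hk => by
    rw [mem_span_groupLike_orthogonal_iff] at hk ⊢
    intro x hx
    rw [ContinuousLinearMap.adjoint_inner_right, hμ.mulL_of_mem_groupLike hx,
      inner_smul_left, hk x hx, mul_zero]
  have hSK : ∀ k ∈ K, S k ∈ K := fun k hk => hadj v _ (hmul v k hk)
  have hSsymm : S.IsSymmetric := fun a b => by
    simp [hS, ContinuousLinearMap.adjoint_inner_left, ContinuousLinearMap.adjoint_inner_right]
  have hcomm : ∀ a z, S (mulL μ a z) = mulL μ a (S z) := fun a z => by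
    rw [hS, ContinuousLinearMap.comp_apply, hμ.mulL_mulL_comm v a, hμ.adjoint_mulL_mulL,
      ContinuousLinearMap.comp_apply]
  -- This suffices, since ‖M_v u‖² = ⟨u, S u⟩.
  have hSu : S u = 0 := by
    by_contra hSu
    obtain ⟨x, hxK, hx, ⟨c, hc, hSx⟩, hχ⟩ := exists_joint_eigenvector_of_isCompactOperator
      (hμ.isCompactOperator_adjoint_mulL_comp v) hSsymm K hSK (fun a => (mulL μ a).toLinearMap)
      hμ.mulL_mulL_comm hcomm hmul hu hSu
    choose χ hχ using hχ
    have hv : χ v ≠ 0 := fun h0 => by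
      have h1 : mulL μ v x = 0 := (hχ v).trans (by rw [h0, zero_smul])
      rw [ContinuousLinearMap.comp_apply, h1, map_zero] at hSx
      exact smul_ne_zero hc hx hSx.symm
    obtain ⟨g, hg, hgx⟩ := hμ.exists_groupLike_of_joint_eigenvector hx hχ hv
    exact hgx (mem_span_groupLike_orthogonal_iff.1 hxK g hg)
  rw [← inner_self_eq_zero (𝕜 := ℂ), ← ContinuousLinearMap.adjoint_inner_right]
  exact (congrArg _ hSu).trans (inner_zero_right _)

/-- The Jacobson radical is the orthogonal complement of the set of group-like elements. -/
theorem IsHilbertianFrobenius.jacobson_eq :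
    jacobson μ = (Submodule.span ℂ (groupLike μ))ᗮ := by
  refine le_antisymm (fun u hu => ?_) (fun u hu => ?_)
  · rw [mem_span_groupLike_orthogonal_iff]
    intro x hx
    exact (Submodule.mem_sInf.1 hu) _ (isMaximalModularIdeal_of_mem_groupLike hx)
  · refine Submodule.mem_sInf.2 fun I hI => ?_
    obtain ⟨e, he⟩ := hI.1
    -- With e the modular unit of I, ue = 0, so u = u - ue lies in I.
    have h := hμ.mulL_eq_zero_of_mem_orthogonal hu e
    rw [hμ.mulL_comm, mulL_apply] at h
    simpa [h] using he u

/-- For n in J, M_u n = 0, hence M_u† n = 0 by normality, and ⟨n, uv⟩ = ⟨M_u† n, v⟩ = 0. -/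
theorem IsHilbertianFrobenius.apply_mem_jacobson_orthogonal (t : HTensor H H) :
    μ t ∈ (jacobson μ)ᗮ := by
  refine mem_of_forall_tmul_mem (V := (jacobson μ)ᗮ.comap μ.toLinearMap)
    ((Submodule.isClosed_orthogonal _).preimage μ.continuous) (fun u v n hn => ?_) t
  rw [hμ.jacobson_eq] at hn
  have h := hμ.mulL_eq_zero_of_mem_orthogonal hn u
  change inner ℂ n (mulL μ u v) = 0
  rw [← ContinuousLinearMap.adjoint_inner_left, (hμ.adjoint_mulL_eq_zero_iff u n).2 h,
    inner_zero_left]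

theorem IsHilbertianFrobenius.isSubalgebra_jacobson_orthogonal :
    IsSubalgebra μ (jacobson μ)ᗮ :=
  ⟨Submodule.isClosed_orthogonal _, fun _ => hμ.apply_mem_jacobson_orthogonal _⟩

theorem IsHilbertianFrobenius.groupLike_subset_jacobson_orthogonal :
    groupLike μ ⊆ (jacobson μ)ᗮ := by
  rw [hμ.jacobson_eq]
  exact Submodule.subset_span.trans (Submodule.le_orthogonal_orthogonal _)

end GroupLike

/-! ### The weight and the Gelfand transform -/

section Representation

variable {H : Type*} [NormedAddCommGroup H] [InnerProductSpace ℂ H] [CompleteSpace H]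
  {μ : HTensor H H →L[ℂ] H}

theorem inv_norm_sq_ge_of_mem_groupLike {x : H} (hx : x ∈ groupLike μ) :
    0 < 1 / ‖μ‖ ^ 2 ∧ 1 / ‖μ‖ ^ 2 ≤ 1 / ‖x‖ ^ 2 := by
  have h0 : 0 < ‖x‖ := norm_pos_iff.2 hx.1
  have h := norm_le_of_mem_groupLike hx
  have h1 := h0.trans_le h
  exact ⟨by positivity, by gcongr⟩

/-- The weight `x ↦ 1 / ‖x‖²` on the group-like elements. -/
def groupLikeWeight (μ : HTensor H H →L[ℂ] H) : Weight (groupLike μ) where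
  toFun x := 1 / ‖(x : H)‖ ^ 2
  bounded_below := by
    obtain h | ⟨⟨y⟩⟩ := isEmpty_or_nonempty (groupLike μ)
    -- Without group-likes ‖μ‖ may be 0, so 1 / ‖μ‖² need not be positive; any positive constant
    -- serves.
    · exact ⟨1, one_pos, fun x => h.elim x⟩
    · exact ⟨1 / ‖μ‖ ^ 2, (inv_norm_sq_ge_of_mem_groupLike y.2).1,
        fun x => (inv_norm_sq_ge_of_mem_groupLike x.2).2⟩

theorem groupLikeWeight_apply (x : groupLike μ) : groupLikeWeight μ x = 1 / ‖(x : H)‖ ^ 2 := rfl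

variable (hμ : IsHilbertianFrobenius μ)

/-- The normalized group-like elements, as vectors of `J^⊥`. -/
def IsHilbertianFrobenius.unitGroupLike (x : groupLike μ) : (jacobson μ)ᗮ :=
  (‖(x : H)‖ : ℂ)⁻¹ • ⟨x, hμ.groupLike_subset_jacobson_orthogonal x.2⟩

theorem IsHilbertianFrobenius.inner_unitGroupLike (x : groupLike μ) (u : (jacobson μ)ᗮ) :
    inner ℂ (hμ.unitGroupLike x) u = (‖(x : H)‖ : ℂ)⁻¹ * inner ℂ (x : H) (u : H) := by
  rw [unitGroupLike, inner_smul_left, map_inv₀, Complex.conj_ofReal, Submodule.coe_inner]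

theorem IsHilbertianFrobenius.orthonormal_unitGroupLike : Orthonormal ℂ hμ.unitGroupLike := by
  refine ⟨fun x => ?_, fun x y hxy => ?_⟩
  · have : ‖(x : H)‖ ≠ 0 := norm_ne_zero_iff.2 x.2.1
    rw [unitGroupLike, norm_smul, Submodule.coe_norm]
    simp [this]
  · change inner ℂ (hμ.unitGroupLike x) (hμ.unitGroupLike y) = 0
    rw [inner_unitGroupLike, unitGroupLike, Submodule.coe_smul, inner_smul_right,
      hμ.inner_eq_zero_of_mem_groupLike x.2 y.2 fun h => hxy (Subtype.ext h)]
    simp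

/-- A vector of J^⊥ orthogonal to all group-likes also lies in J, hence is orthogonal to itself. -/
theorem IsHilbertianFrobenius.span_unitGroupLike_orthogonal :
    (Submodule.span ℂ (Set.range hμ.unitGroupLike))ᗮ = ⊥ := by
  refine (Submodule.eq_bot_iff _).2 fun u hu => ?_
  have hJ : (u : H) ∈ jacobson μ := by
    refine hμ.jacobson_eq.ge (mem_span_groupLike_orthogonal_iff.2 fun x hx => ?_)
    have h := hu _ (Submodule.subset_span ⟨⟨x, hx⟩, rfl⟩)
    rw [inner_unitGroupLike] at h
    exact (mul_eq_zero.1 h).resolve_left (by simpa using hx.1)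
  exact Subtype.ext ((inner_self_eq_zero (𝕜 := ℂ)).1 (u.2 u hJ))

/-- The Hilbert basis of `J^⊥` formed by the normalized group-like elements. -/
def IsHilbertianFrobenius.groupLikeBasis : HilbertBasis (groupLike μ) ℂ (jacobson μ)ᗮ :=
  HilbertBasis.mkOfOrthogonalEqBot hμ.orthonormal_unitGroupLike hμ.span_unitGroupLike_orthogonal

/-- The Gelfand transform `u ↦ (x ↦ ⟪x, u⟫)` as a unitary map `J^⊥ → ℓ²_w(G)`. -/
def IsHilbertianFrobenius.gelfand : (jacobson μ)ᗮ ≃ₗᵢ[ℂ] WL2 (groupLikeWeight μ) :=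
  hμ.groupLikeBasis.repr.trans (WL2.toLp (groupLikeWeight μ)).symm

theorem IsHilbertianFrobenius.gelfand_apply (u : (jacobson μ)ᗮ) (x : groupLike μ) :
    hμ.gelfand u x = inner ℂ (x : H) (u : H) := by
  have hx : (‖(x : H)‖ : ℂ) ≠ 0 := by simpa using x.2.1
  have hb : hμ.groupLikeBasis.repr u x = (‖(x : H)‖ : ℂ)⁻¹ * inner ℂ (x : H) (u : H) := by
    rw [HilbertBasis.repr_apply_apply, groupLikeBasis, HilbertBasis.coe_mkOfOrthogonalEqBot,
      inner_unitGroupLike]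
  -- The factor w(x)^{-1/2} = ‖x‖ cancels the normalization of the basis vector.
  change (Real.sqrt (groupLikeWeight μ x) : ℂ)⁻¹ * hμ.groupLikeBasis.repr u x = _
  rw [hb, groupLikeWeight_apply, Real.sqrt_div zero_le_one, Real.sqrt_one,
    Real.sqrt_sq (norm_nonneg _)]
  push_cast
  field_simp

theorem IsHilbertianFrobenius.gelfand_isSemigroupHom (hJ : IsSubalgebra μ (jacobson μ)ᗮ) :
    IsSemigroupHom (restrict μ (jacobson μ)ᗮ hJ) (WL2.mul (groupLikeWeight μ))
      (hμ.gelfand.toContinuousLinearEquiv : (jacobson μ)ᗮ →L[ℂ] WL2 (groupLikeWeight μ)) := by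
  refine clm_ext_tmul fun u v => WL2.ext fun x => ?_
  rw [ContinuousLinearMap.comp_apply, ContinuousLinearMap.comp_apply, tmap_tmul, WL2.mul_tmul]
  change hμ.gelfand _ x = hμ.gelfand u x * hμ.gelfand v x
  rw [gelfand_apply, gelfand_apply, gelfand_apply, ← (mem_groupLike_iff.1 x.2).2]
  change inner ℂ (x : H) (μ (tmap _ _ (tmul u v))) = _
  rw [tmap_tmul]
  rfl

end Representation

/-! ### The inverse morphism and the structure theorem -/

/-- The inverse of a bijective semigroup morphism is a semigroup morphism. -/
theorem IsSemigroupHom.symm {H K : Type*}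
    [NormedAddCommGroup H] [InnerProductSpace ℂ H] [NormedAddCommGroup K] [InnerProductSpace ℂ K]
    {μ : HTensor H H →L[ℂ] H} {γ : HTensor K K →L[ℂ] K} {U : H ≃L[ℂ] K}
    (h : IsSemigroupHom μ γ (U : H →L[ℂ] K)) : IsSemigroupHom γ μ (U.symm : K →L[ℂ] H) := by
  refine clm_ext_tmul fun u v => U.injective ?_
  have := DFunLike.congr_fun h (tmul (U.symm u) (U.symm v))
  simp only [ContinuousLinearMap.comp_apply, tmap_tmul, ContinuousLinearEquiv.coe_coe,
    ContinuousLinearEquiv.apply_symm_apply] at this ⊢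
  exact this.symm

end HilbFrob
end

theorem mainTheorem7 {H : Type*} [NormedAddCommGroup H] [InnerProductSpace ℂ H] [CompleteSpace H]
    (μ : HilbFrob.HTensor H H →L[ℂ] H) (hμ : HilbFrob.IsHilbertianFrobenius μ) :
    ∃ (hJ : HilbFrob.IsSubalgebra μ (HilbFrob.jacobson μ)ᗮ)
      (w : HilbFrob.Weight (HilbFrob.groupLike μ)),
      (∀ x : HilbFrob.groupLike μ, w x = 1 / ‖(x : H)‖ ^ 2) ∧
      (∀ x : HilbFrob.groupLike μ, 0 < 1 / ‖μ‖ ^ 2 ∧ 1 / ‖μ‖ ^ 2 ≤ w x) ∧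
      HilbFrob.UnitarilyIsomorphic
        (HilbFrob.restrict μ (HilbFrob.jacobson μ)ᗮ hJ) (HilbFrob.WL2.mul w) := by
  exact ⟨hμ.isSubalgebra_jacobson_orthogonal, HilbFrob.groupLikeWeight μ, fun _ => rfl,
    fun x => HilbFrob.inv_norm_sq_ge_of_mem_groupLike x.2, hμ.gelfand,
    hμ.gelfand_isSemigroupHom _, (hμ.gelfand_isSemigroupHom _).symm⟩
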